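/- Let $X$ be a locally finite, connected CW-complex, i.e. a Hausdorff space with a CW-structure such that every point of $X$ has a neighbourhood meeting only finitely many cells. If $X$ is contractible, then for every $n \in \mathbb{N}$ there exists a majority function on $X$ for $n$ agents, that is, a continuous function $M : X^n \to X$ (where $X^n$ carries the product topology) such that for all $x_1, \dots, x_n, y \in X$: if more than half of the arguments $x_1, \dots, x_n$ are equal to $y$ (that is, $2\,\lvert\{ i : x_i = y\}\rvert > n$), then $M(x_1, \dots, x_n) = y$. -/

import Mathlib

namespace MajorityChoice

/-- A CW complex is locally finite if every point has a neighbourhood that meets only finitely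
many of its (closed) cells. -/
def IsLocallyFiniteCW {X : Type*} [TopologicalSpace X] (C : Set X) [Topology.CWComplex C] : Prop :=
  LocallyFinite fun e : (Σ n : ℕ, Topology.RelCWComplex.cell C n) =>
    Topology.RelCWComplex.closedCell (C := C) e.1 e.2

/-- A majority function for `n` agents on the choice space `X`: a continuous function
`M : X ^ n → X` (for the product topology on `X ^ n`) that takes the value `y` at every
tuple more than half of whose entries are equal to `y`. -/
structure IsMajorityFunction {X : Type*} [TopologicalSpace X] {n : ℕ} (M : (Fin n → X) → X) :
    Prop where
  continuous : Continuous M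
  majority : ∀ (x : Fin n → X) (y : X), n < 2 * {i : Fin n | x i = y}.ncard → M x = y

end MajorityChoice

/-!
# Majority functions on contractible locally finite CW complexes

A tuple has at most one majority value, and the tuples that have one form a closed subset `A` of
`X ^ n` on which the majority value is a continuous function: `A` is the finite union of the closed
sets of tuples that are constant on a fixed majority of the agents
(`exists_continuousOn_majority`). A majority function is therefore the same thing as a continuous
extension of this function from `A` to `X ^ n`, and it suffices to show that `X` is an absolute
extensor for metrizable spaces and that `X ^ n` is metrizable.

A connected locally finite complex has countably many cells, so it is second countable, and being
locally compact and Hausdorff it is metrizable (`IsLocallyFiniteCW.metrizableSpace`). A contractible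
absolute neighbourhood extensor is an absolute extensor (`IsANE.exists_continuous_eqOn`), which
reduces the problem to extending maps into `X` from closed sets to neighbourhoods.

For a finite subcomplex this goes by induction on the number of cells
(`IsANE.union_image_closedBall`, `IsCellClosed.isANE_cellUnion`). If `K` is a finite subcomplex and
a cell is attached to it, the result is covered by the open cell, to which Tietze's theorem applies,
and the complement of the centre of the cell, which is an open mapping cylinder neighbourhood
of `K`. The main step is that such a neighbourhood inherits the extension property from `K` and
from the part outside of `K` (`IsANE.of_mappingCylinder`); two relatively open pieces are then glued
along a level set of a Urysohn function (`IsANE.of_isOpen_cover`). Finally, `X` is exhausted by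
compact sets, the interior of each of which is open in a finite subcomplex. The layers between
successive compact sets give two families of disjoint open sets that cover `X` together, so that
the gluing of two pieces suffices once more (`isANE_univ_of_compactExhaustion`).
-/

open Set Filter Topology Metric TopologicalSpace
open scoped Function

namespace MajorityChoice

universe u

variable {X : Type u} [TopologicalSpace X]

/-! ### Absolute neighbourhood extensors -/

/-- A subset `S` of `X` is an absolute neighbourhood extensor (for metrizable spaces): every
continuous map into `S` from a closed subset `A` of a metrizable space `Y` extends continuously,
with values in `S`, to an open neighbourhood of `A`. Partial maps are encoded as total functions
`Y → X` that are `ContinuousOn` their domain. The space `Y` ranges over the universe of `X`, which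
contains the powers `Fin n → X`. -/
def IsANE (S : Set X) : Prop :=
  ∀ (Y : Type u) [TopologicalSpace Y] [MetrizableSpace Y] (A : Set Y) (f : Y → X),
    IsClosed A → ContinuousOn f A → MapsTo f A S →
      ∃ U, IsOpen U ∧ A ⊆ U ∧ ∃ g : Y → X, ContinuousOn g U ∧ MapsTo g U S ∧ EqOn g f A

/-- For an absolute neighbourhood extensor, the set `A` need only be closed in an open set `W`. -/
lemma IsANE.exists_extension_of_inter {S : Set X} (hS : IsANE S) {Y : Type u} [TopologicalSpace Y]
    [MetrizableSpace Y] {A W : Set Y} {f : Y → X} (hA : IsClosed A) (hW : IsOpen W)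
    (hf : ContinuousOn f (A ∩ W)) (hfS : MapsTo f (A ∩ W) S) :
    ∃ U ⊆ W, IsOpen U ∧ A ∩ W ⊆ U ∧
      ∃ g : Y → X, ContinuousOn g U ∧ MapsTo g U S ∧ EqOn g f (A ∩ W) := by
  classical
  obtain ⟨U, hU, hAU, g, hg, hgS, hgf⟩ := hS W (Subtype.val ⁻¹' A) (f ∘ Subtype.val)
    (hA.preimage continuous_subtype_val)
    (hf.comp continuous_subtype_val.continuousOn fun y hy => ⟨hy, y.2⟩)
    (fun y hy => hfS ⟨hy, y.2⟩)
  refine ⟨Subtype.val '' U, Subtype.coe_image_subset W U, hW.isOpenMap_subtype_val U hU,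
    fun y hy => ⟨⟨y, hy.2⟩, hAU hy.1, rfl⟩,
    fun y => if hy : y ∈ W then g ⟨y, hy⟩ else f y, ?_, ?_, ?_⟩
  · rintro _ ⟨y, hy, rfl⟩
    refine ContinuousAt.continuousWithinAt ?_
    rw [← hW.isOpenEmbedding_subtypeVal.continuousAt_iff]
    refine (hg.continuousAt (hU.mem_nhds hy)).congr (Eventually.of_forall fun z => ?_)
    simp
  · rintro _ ⟨y, hy, rfl⟩
    simpa using hgS hy
  · rintro y ⟨hyA, hyW⟩
    simpa [hyW] using hgf (x := ⟨y, hyW⟩) hyA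

lemma IsANE.inter_isOpen {S O : Set X} (hS : IsANE S) (hO : IsOpen O) : IsANE (S ∩ O) := by
  intro Y _ _ A f hA hf hfS
  obtain ⟨U, hU, hAU, g, hg, hgS, hgf⟩ := hS Y A f hA hf (hfS.mono_right inter_subset_left)
  refine ⟨U ∩ g ⁻¹' O, hg.isOpen_inter_preimage hU hO, fun a ha => ⟨hAU ha, ?_⟩, g,
    hg.mono inter_subset_left, fun y hy => ⟨hgS hy.1, hy.2⟩, hgf⟩
  rw [mem_preimage, hgf ha]
  exact (hfS ha).2

/-- A union of two relatively open absolute neighbourhood extensors is one. The domain is cut along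
a level set of a Urysohn function into the parts mapped to `O₁` and to `O₂`; the map is extended
near the cut first, and then to both sides. -/
lemma IsANE.of_isOpen_cover {S O₁ O₂ : Set X} (hO₁ : IsOpen O₁) (hO₂ : IsOpen O₂)
    (hS : S ⊆ O₁ ∪ O₂) (h₁ : IsANE (S ∩ O₁)) (h₂ : IsANE (S ∩ O₂)) : IsANE S := by
  classical
  intro Y _ _ A f hA hf hfS
  have hC : ∀ {O : Set X}, IsOpen O → IsClosed (A ∩ f ⁻¹' Oᶜ) := fun hO =>
    hf.preimage_isClosed_of_isClosed hA hO.isClosed_compl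
  obtain ⟨u, hu0, hu1, -⟩ := exists_continuous_zero_one_of_isClosed (hC hO₂) (hC hO₁) <| by
    rw [Set.disjoint_left]
    rintro y ⟨hy, hy2⟩ ⟨-, hy1⟩
    exact (hS (hfS hy)).elim hy1 hy2
  have hle : IsClosed {y | u y ≤ 1 / 2} := isClosed_le u.continuous continuous_const
  have hge : IsClosed {y | 1 / 2 ≤ u y} := isClosed_le continuous_const u.continuous
  have hf1 : ∀ y ∈ A, u y ≤ 1 / 2 → f y ∈ S ∩ O₁ := fun y hy hy' => ⟨hfS hy, by
    by_contra h
    have := hu1 ⟨hy, h⟩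
    simp only [Pi.one_apply] at this
    norm_num [this] at hy'⟩
  have hf2 : ∀ y ∈ A, 1 / 2 ≤ u y → f y ∈ S ∩ O₂ := fun y hy hy' => ⟨hfS hy, by
    by_contra h
    have := hu0 ⟨hy, h⟩
    simp only [Pi.zero_apply] at this
    norm_num [this] at hy'⟩
  -- the extension `g₀` near the cut
  have hE : IsClosed (A ∩ ({y | u y ≤ 1 / 2} ∩ {y | 1 / 2 ≤ u y})) := hA.inter (hle.inter hge)
  obtain ⟨U₀, hU₀, hEU₀, g₀, hg₀, hg₀S, hg₀f⟩ := h₁.inter_isOpen hO₂ Y _ f hE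
    (hf.mono inter_subset_left) (fun y hy => ⟨hf1 y hy.1 hy.2.1, (hf2 y hy.1 hy.2.2).2⟩)
  obtain ⟨N, hN, hEN, hNU₀⟩ := normal_exists_closure_subset hE hU₀ hEU₀
  set D : Set Y := closure N ∩ ({y | u y ≤ 1 / 2} ∩ {y | 1 / 2 ≤ u y}) with hD
  have hDc : IsClosed D := isClosed_closure.inter (hle.inter hge)
  set k : Y → X := fun y => if y ∈ A then f y else g₀ y with hk
  have hkA : EqOn k f A := fun y hy => if_pos hy
  have hkD : EqOn k g₀ D := fun y hy => by
    by_cases h : y ∈ A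
    · rw [hkA h, hg₀f ⟨h, hy.2⟩]
    · exact if_neg h
  have key : ∀ {R : Set Y} {O : Set X}, IsClosed R → IsANE (S ∩ O) →
      (∀ y ∈ A, y ∈ R → f y ∈ S ∩ O) → S ∩ O₁ ∩ O₂ ⊆ S ∩ O →
      ∃ U, IsOpen U ∧ (A ∩ R) ∪ D ⊆ U ∧
        ∃ g : Y → X, ContinuousOn g U ∧ MapsTo g U (S ∩ O) ∧ EqOn g k ((A ∩ R) ∪ D) := by
    intro R O hR hO hfR hSO
    refine hO Y _ k ((hA.inter hR).union hDc) ?_ ?_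
    · refine ContinuousOn.union_of_isClosed ?_ ?_ (hA.inter hR) hDc
      · exact (hf.mono inter_subset_left).congr (hkA.mono inter_subset_left)
      · exact (hg₀.mono (inter_subset_left.trans hNU₀)).congr hkD
    · rintro y (hy | hy)
      · rw [hkA hy.1]
        exact hfR y hy.1 hy.2
      · rw [hkD hy]
        exact hSO (hg₀S (hNU₀ hy.1))
  obtain ⟨U₁, hU₁, hAU₁, g₁, hg₁, hg₁S, hg₁k⟩ := key hle h₁ hf1 (fun x hx => hx.1)
  obtain ⟨U₂, hU₂, hAU₂, g₂, hg₂, hg₂S, hg₂k⟩ := key hge h₂ hf2 (fun x hx => ⟨hx.1.1, hx.2⟩)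
  -- the domain of the glued map
  set U : Set Y := (U₁ ∩ {y | u y < 1 / 2}) ∪ (U₂ ∩ {y | 1 / 2 < u y}) ∪ (U₁ ∩ U₂ ∩ N) with hU
  have hUo : IsOpen U :=
    ((hU₁.inter (isOpen_lt u.continuous continuous_const)).union
      (hU₂.inter (isOpen_lt continuous_const u.continuous))).union ((hU₁.inter hU₂).inter hN)
  have hUle : ∀ y ∈ U, u y ≤ 1 / 2 → y ∈ U₁ := by
    rintro y ((hy | hy) | hy) h
    · exact hy.1
    · exact absurd h (not_le.2 hy.2)
    · exact hy.1.1
  have hUge : ∀ y ∈ U, 1 / 2 ≤ u y → y ∈ U₂ := by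
    rintro y ((hy | hy) | hy) h
    · exact absurd h (not_le.2 hy.2)
    · exact hy.1
    · exact hy.1.2
  refine ⟨U, hUo, fun y hy => ?_, fun y => if u y ≤ 1 / 2 then g₁ y else g₂ y, ?_, ?_, ?_⟩
  · rcases lt_trichotomy (u y) (1 / 2) with h | h | h
    · exact Or.inl (Or.inl ⟨hAU₁ (Or.inl ⟨hy, h.le⟩), h⟩)
    · exact Or.inr ⟨⟨hAU₁ (Or.inl ⟨hy, h.le⟩), hAU₂ (Or.inl ⟨hy, h.ge⟩)⟩, hEN ⟨hy, h.le, h.ge⟩⟩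
    · exact Or.inl (Or.inr ⟨hAU₂ (Or.inl ⟨hy, h.le⟩), h⟩)
  · refine ContinuousOn.if ?_ ?_ ?_
    · rintro y ⟨hy, hyf⟩
      have h : u y = 1 / 2 := frontier_le_subset_eq u.continuous continuous_const hyf
      have hyD : y ∈ D := by
        rcases hy with (hy | hy) | hy
        · exact absurd h hy.2.ne
        · exact absurd h hy.2.ne'
        · exact ⟨subset_closure hy.2, h.le, h.ge⟩
      rw [hg₁k (Or.inr hyD), hg₂k (Or.inr hyD)]
    · rw [hle.closure_eq]
      exact hg₁.mono fun y hy => hUle y hy.1 hy.2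
    · refine hg₂.mono fun y hy => hUge y hy.1 ?_
      refine closure_minimal (fun z hz => ?_) hge hy.2
      exact (not_le.1 hz).le
  · intro y hy
    dsimp only
    split_ifs with h
    · exact (hg₁S (hUle y hy h)).1
    · exact (hg₂S (hUge y hy (not_le.1 h).le)).1
  · intro y hy
    dsimp only
    split_ifs with h
    · rw [hg₁k (Or.inl ⟨hy, h⟩), hkA hy]
    · rw [hg₂k (Or.inl ⟨hy, (not_le.1 h).le⟩), hkA hy]

/-- A union of pairwise disjoint open absolute neighbourhood extensors is one: their preimages
in `A` can be separated by disjoint open sets. -/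
lemma IsANE.iUnion_of_disjoint {ι : Type*} {O : ι → Set X} (hO : ∀ i, IsOpen (O i))
    (hd : Pairwise (Disjoint on O)) (h : ∀ i, IsANE (O i)) : IsANE (⋃ i, O i) := by
  classical
  intro Y _ _ A f hA hf hfS
  let _ := metrizableSpaceMetric Y
  set B : ι → Set Y := fun i => A ∩ f ⁻¹' O i with hB
  set C : ι → Set Y := fun i => A ∩ f ⁻¹' (O i)ᶜ with hC
  have hCc : ∀ i, IsClosed (C i) := fun i =>
    hf.preimage_isClosed_of_isClosed hA (hO i).isClosed_compl
  have hBc : ∀ i, IsClosed (B i) := by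
    intro i
    have : B i = A ∩ f ⁻¹' (⋃ j ∈ {j | j ≠ i}, O j)ᶜ := by
      ext y
      simp only [hB, mem_inter_iff, mem_preimage, mem_compl_iff, mem_iUnion, not_exists]
      refine and_congr_right fun hy => ⟨fun hi j hj hyj => ?_, fun hi => ?_⟩
      · exact Set.disjoint_left.1 (hd hj) hyj hi
      · obtain ⟨j, hj⟩ := mem_iUnion.1 (hfS hy)
        by_cases hji : j = i
        · exact hji ▸ hj
        · exact absurd hj (hi j hji)
    rw [this]
    exact hf.preimage_isClosed_of_isClosed hA
      (isOpen_biUnion fun j _ => hO j).isClosed_compl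
  -- disjoint neighbourhoods of the sets `B i`
  set W : ι → Set Y := fun i => {y | infEDist y (B i) < infEDist y (C i)} with hW
  have hWo : ∀ i, IsOpen (W i) := fun i => isOpen_lt continuous_infEDist continuous_infEDist
  have hBW : ∀ i, B i ⊆ W i := fun i y hy => by
    change infEDist y (B i) < infEDist y (C i)
    rw [infEDist_zero_of_mem hy, pos_iff_ne_zero, ne_eq,
      ← mem_iff_infEDist_zero_of_closed (hCc i)]
    exact fun h => h.2 hy.2
  have hBC : ∀ {i j}, i ≠ j → B i ⊆ C j := fun hij y hy =>
    ⟨hy.1, fun h => Set.disjoint_left.1 (hd hij) hy.2 h⟩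
  have hWd : ∀ {i j y}, y ∈ W i → y ∈ W j → i = j := by
    intro i j y hi hj
    by_contra hij
    have h1 : infEDist y (C i) ≤ infEDist y (B j) := infEDist_anti (hBC (Ne.symm hij))
    have h2 : infEDist y (C j) ≤ infEDist y (B i) := infEDist_anti (hBC hij)
    exact absurd (hi.trans_le (h1.trans_lt (hj.trans_le h2)).le) (lt_irrefl _)
  have key := fun i => (h i).exists_extension_of_inter (hBc i) (hWo i)
    (hf.mono (inter_subset_left.trans inter_subset_left)) (fun y hy => hy.1.2)
  choose U hUW hU hBU g hg hgO hgf using key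
  set G : Y → X := fun y => if hy : ∃ i, y ∈ W i then g hy.choose y else f y with hG
  have hGg : ∀ i, EqOn G (g i) (W i) := by
    intro i y hy
    have hex : ∃ i, y ∈ W i := ⟨i, hy⟩
    have : hex.choose = i := hWd hex.choose_spec hy
    simp only [hG, dif_pos hex, this]
  refine ⟨⋃ i, U i, isOpen_iUnion hU, fun y hy => ?_, G, ?_, ?_, ?_⟩
  · obtain ⟨i, hi⟩ := mem_iUnion.1 (hfS hy)
    exact mem_iUnion.2 ⟨i, hBU i ⟨⟨hy, hi⟩, hBW i ⟨hy, hi⟩⟩⟩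
  · exact ContinuousOn.iUnion_of_isOpen (fun i => (hg i).congr ((hGg i).mono (hUW i))) hU
  · intro y hy
    obtain ⟨i, hi⟩ := mem_iUnion.1 hy
    rw [hGg i (hUW i hi)]
    exact mem_iUnion.2 ⟨i, hgO i hi⟩
  · intro y hy
    obtain ⟨i, hi⟩ := mem_iUnion.1 (hfS hy)
    have hyB : y ∈ B i := ⟨hy, hi⟩
    rw [hGg i (hBW i hyB), hgf i ⟨hyB, hBW i hyB⟩]

/-- A space exhausted by compact sets whose interiors are absolute neighbourhood extensors is one:
the open layers between every second pair of successive compact sets are disjoint, and the layers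
of odd and of even index together cover the space. -/
lemma isANE_univ_of_compactExhaustion [T2Space X] (K : CompactExhaustion X)
    (h : ∀ n, IsANE (interior (K n))) : IsANE (univ : Set X) := by
  -- `L k` is the part of the interior of `K (k + 1)` outside `K (k - 1)`
  set L : ℕ → Set X := fun k => interior (K (k + 1)) \ (if k = 0 then ∅ else K (k - 1)) with hL
  have hLo : ∀ k, IsOpen (L k) := fun k => by
    refine isOpen_interior.sdiff ?_
    split_ifs
    · exact isClosed_empty
    · exact (K.isCompact _).isClosed
  have hLA : ∀ k, IsANE (L k) := fun k => by
    have : L k = interior (K (k + 1)) ∩ L k := by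
      rw [eq_comm, inter_eq_right]
      exact sdiff_subset
    rw [this]
    exact (h _).inter_isOpen (hLo k)
  have hLd : ∀ {j k}, j + 2 ≤ k → Disjoint (L j) (L k) := by
    intro j k hjk
    rw [Set.disjoint_left]
    rintro x ⟨hx, -⟩ ⟨-, hx'⟩
    rw [if_neg (by lia)] at hx'
    exact hx' (K.subset (by lia) (interior_subset hx))
  have hLd' : ∀ r, Pairwise (Disjoint on fun i : ℕ => L (2 * i + r)) := by
    intro r i j hij
    rcases Nat.lt_or_gt_of_ne hij with hlt | hlt
    · exact hLd (by lia)
    · exact (hLd (by lia)).symm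
  have hLU : ∀ r, IsANE (⋃ i : ℕ, L (2 * i + r)) := fun r =>
    IsANE.iUnion_of_disjoint (fun i => hLo _) (hLd' r) fun i => hLA _
  refine IsANE.of_isOpen_cover (isOpen_iUnion fun i => hLo (2 * i + 0))
    (isOpen_iUnion fun i => hLo (2 * i + 1)) ?_ ?_ ?_
  · intro x _
    have hx : ∃ n, x ∈ K n := K.exists_mem x
    classical
    set n := Nat.find hx with hn
    have hxn : x ∈ L n := by
      refine ⟨K.subset_interior_succ n (Nat.find_spec hx), ?_⟩
      split_ifs with h0
      · exact notMem_empty _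
      · exact Nat.find_min hx (show n - 1 < n by lia)
    rcases Nat.even_or_odd' n with ⟨i, hi | hi⟩
    · exact Or.inl (mem_iUnion.2 ⟨i, by rwa [add_zero, ← hi]⟩)
    · exact Or.inr (mem_iUnion.2 ⟨i, by rwa [← hi]⟩)
  · rw [univ_inter]; exact hLU 0
  · rw [univ_inter]; exact hLU 1

/-! ### Mapping cylinder neighbourhoods -/

/-- If `S` is an open mapping cylinder neighbourhood of `K`, and both `K` and `S \ K` are absolute
neighbourhood extensors, then so is `S`. The mapping cylinder structure is given by the height
`t : S → [0, 1)`, which vanishes on `K`, the retraction `r : S → K` along the rays, and the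
map `h` that moves a point of `S \ K` along its ray to a prescribed height; `hN` says that `t` and
`r` determine the topology of `S` at the points of `K`.

A map `f` on `A` is extended in three stages: the part with values in `S \ K` to a map `P` near
`A \ f⁻¹' K`; then `r ∘ P`, together with `f` on `f⁻¹' K`, to a map `G` into `K`; and the height
`t ∘ f` to a function `T` that vanishes away from the domain of `P`. The extension of `f` is
`h (P y) (T y)` where `P` is used and `G` elsewhere. -/
lemma IsANE.of_mappingCylinder [MetrizableSpace X] {K S : Set X} (hK : IsClosed K) (hKS : K ⊆ S)
    (hKA : IsANE K) (hSA : IsANE (S \ K)) {t : X → ℝ} {r : X → X} {h : X → ℝ → X}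
    (htc : ContinuousOn t S) (hrc : ContinuousOn r S)
    (hhc : ContinuousOn (fun p : X × ℝ => h p.1 p.2) ((S \ K) ×ˢ Ico 0 1))
    (ht : MapsTo t S (Ico 0 1)) (htK : ∀ x ∈ K, t x = 0)
    (hr : MapsTo r S K) (hrK : ∀ x ∈ K, r x = x)
    (hh : ∀ x ∈ S \ K, ∀ τ ∈ Ico (0 : ℝ) 1, h x τ ∈ S ∧ t (h x τ) = τ ∧ r (h x τ) = r x)
    (hht : ∀ x ∈ S \ K, h x (t x) = x)
    (hN : ∀ k ∈ K, comap t (𝓝 0) ⊓ comap r (𝓝 k) ⊓ 𝓟 S ≤ 𝓝 k) : IsANE S := by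
  classical
  intro Y _ _ A f hA hf hfS
  let _ := metrizableSpaceMetric Y
  let _ := metrizableSpaceMetric X
  set B : Set Y := A ∩ f ⁻¹' K with hB
  have hBc : IsClosed B := hf.preimage_isClosed_of_isClosed hA hK
  have hfB : MapsTo f (A \ B) (S \ K) := fun y hy => ⟨hfS hy.1, fun h => hy.2 ⟨hy.1, h⟩⟩
  obtain ⟨V, hVB, hV, hAV, P, hP, hPS, hPf⟩ := hSA.exists_extension_of_inter hA hBc.isOpen_compl
    (hf.mono inter_subset_left) hfB
  have hrP : ContinuousOn (fun y => r (P y)) V :=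
    hrc.comp hP fun y hy => (hPS hy).1
  -- the points at which `r ∘ P` is controlled by the distance to `B`
  set O : Set Y := {y | y ∈ V ∧ ∃ a ∈ A \ B, ∃ ε > 0, (∀ b ∈ B, ε ≤ dist a b) ∧
    dist y a < ε / 2 ∧ dist (r (P y)) (r (P a)) < ε} with hO
  have hOo : IsOpen O := by
    have : O = ⋃ a ∈ A \ B, ⋃ ε ∈ {ε : ℝ | 0 < ε ∧ ∀ b ∈ B, ε ≤ dist a b},
        (V ∩ (fun y => r (P y)) ⁻¹' ball (r (P a)) ε) ∩ ball a (ε / 2) := by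
      ext y
      simp only [hO, mem_ofPred_eq, mem_iUnion, mem_inter_iff, mem_preimage, mem_ball, exists_prop]
      constructor
      · rintro ⟨h1, a, ha, ε, hε, h2, h3, h4⟩
        exact ⟨a, ha, ε, ⟨hε, h2⟩, ⟨h1, h4⟩, h3⟩
      · rintro ⟨a, ha, ε, ⟨hε, h2⟩, ⟨h1, h4⟩, h3⟩
        exact ⟨h1, a, ha, ε, hε, h2, h3, h4⟩
    rw [this]
    exact isOpen_biUnion fun a _ => isOpen_biUnion fun ε _ =>
      (hrP.isOpen_inter_preimage hV isOpen_ball).inter isOpen_ball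
  have hABO : A \ B ⊆ O := by
    intro a ha
    obtain ⟨ε, hε, hεB⟩ := Metric.isOpen_iff.1 hBc.isOpen_compl a ha.2
    refine ⟨hAV ha, a, ha, ε, hε, fun b hb => ?_, by simpa using hε, by simpa using hε⟩
    by_contra hlt
    exact hεB (mem_ball'.2 (not_le.1 hlt)) hb
  have hOB : ∀ y ∈ O, y ∉ B := fun y hy => hVB hy.1
  have hZ : IsClosed Oᶜ := hOo.isClosed_compl
  -- `C` contains `A` in its interior, away from `B`, and is contained in `O ∪ B`
  set C : Set Y := {y | infEDist y A ≤ infEDist y Oᶜ} with hC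
  have hCc : IsClosed C := isClosed_le continuous_infEDist continuous_infEDist
  have hAC : A ⊆ C := fun y hy => by
    change infEDist y A ≤ _
    rw [infEDist_zero_of_mem hy]
    exact zero_le
  have hCO : ∀ y ∈ C, y ∉ B → y ∈ O := by
    intro y hy hyB
    by_contra hyO
    have h0 : infEDist y A ≤ 0 := (infEDist_zero_of_mem (show y ∈ Oᶜ from hyO)) ▸ hy
    have hyA : y ∈ A := (mem_iff_infEDist_zero_of_closed hA).2 (nonpos_iff_eq_zero.1 h0)
    exact hyO (hABO ⟨hyA, hyB⟩)
  set g : Y → X := fun y => if y ∈ B then f y else r (P y) with hg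
  have hgB : ∀ y ∈ B, g y = f y := fun y hy => if_pos hy
  have hgP : ∀ y ∉ B, g y = r (P y) := fun y hy => if_neg hy
  have hgA : ∀ a ∈ A, g a = r (f a) := by
    intro a ha
    by_cases haB : a ∈ B
    · rw [hgB a haB, hrK _ haB.2]
    · rw [hgP a haB, hPf ⟨ha, haB⟩]
  have hrf : ContinuousOn (fun y => r (f y)) A := hrc.comp hf hfS
  have hgc : ContinuousOn g C := by
    intro y hy
    by_cases hyB : y ∈ B
    · rw [Metric.continuousWithinAt_iff]
      intro η hη
      obtain ⟨δ, hδ, hδf⟩ := Metric.continuousWithinAt_iff.1 (hrf y hyB.1) (η / 2) (half_pos hη)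
      refine ⟨min (δ / 2) (η / 4), by positivity, fun z hz hzy => ?_⟩
      obtain ⟨hz1, hz2⟩ := lt_min_iff.1 hzy
      rw [hgA y hyB.1]
      by_cases hzB : z ∈ B
      · rw [hgA z hzB.1]
        exact (hδf hzB.1 (by linarith)).trans (by linarith)
      · obtain ⟨-, a, ha, ε, hε, hεB, hza, hrza⟩ := hCO z hz hzB
        have h1 := hεB y hyB
        have h2 : dist a y ≤ dist z a + dist z y := dist_triangle_left a y z
        have h3 := hδf ha.1 (show dist a y < δ by linarith)
        rw [hPf ha] at hrza
        rw [hgP z hzB]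
        linarith [dist_triangle (r (P z)) (r (f a)) (r (f y))]
    · have hyV := (hCO y hy hyB).1
      refine ((hrP.continuousAt (hV.mem_nhds hyV)).congr ?_).continuousWithinAt
      filter_upwards [hV.mem_nhds hyV] with z hz
      exact (hgP z (hVB hz)).symm
  have hgK : MapsTo g C K := by
    intro y hy
    by_cases hyB : y ∈ B
    · rw [hgB y hyB]
      exact hyB.2
    · rw [hgP y hyB]
      exact hr (hPS (hCO y hy hyB).1).1
  obtain ⟨U, hU, hCU, G, hG, hGK, hGg⟩ := hKA Y C g hCc hgc hgK
  -- the height function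
  set D : Set Y := {y | infEDist y Oᶜ ≤ infEDist y A} with hD
  have hDc : IsClosed D := isClosed_le continuous_infEDist continuous_infEDist
  have hAD : ∀ y ∈ A, y ∈ D → y ∈ B := by
    intro y hy hyD
    by_contra hyB
    have h0 : infEDist y Oᶜ ≤ 0 := (infEDist_zero_of_mem hy) ▸ hyD
    exact (mem_iff_infEDist_zero_of_closed hZ).2 (nonpos_iff_eq_zero.1 h0) (hABO ⟨hy, hyB⟩)
  set t₀ : Y → ℝ := fun y => if y ∈ A then t (f y) else 0 with ht₀
  have ht₀A : EqOn t₀ (fun y => t (f y)) A := fun y hy => if_pos hy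
  have ht₀D : EqOn t₀ (fun _ => 0) D := fun y hy => by
    by_cases hyA : y ∈ A
    · rw [ht₀A hyA]
      exact htK _ (hAD y hyA hy).2
    · exact if_neg hyA
  have ht₀c : ContinuousOn t₀ (A ∪ D) :=
    ((htc.comp hf hfS).congr ht₀A).union_of_isClosed (continuousOn_const.congr ht₀D) hA hDc
  obtain ⟨T, hT01, hTt⟩ := ContinuousMap.exists_restrict_eq_forall_mem_of_closed
    (⟨(A ∪ D).domRestrict t₀, ht₀c.domRestrict⟩ : C(↥(A ∪ D), ℝ)) (t := Ico 0 1)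
    (by
      rintro ⟨y, hy⟩
      simp only [ContinuousMap.coe_mk, domRestrict_apply, ht₀]
      split_ifs with hyA
      · exact ht (hfS hyA)
      · simp)
    ⟨0, by simp⟩ (hA.union hDc)
  have hTt' : EqOn T t₀ (A ∪ D) := fun y hy => DFunLike.congr_fun hTt ⟨y, hy⟩
  have hTD : ∀ y ∈ D, T y = 0 := fun y hy => (hTt' (Or.inr hy)).trans (ht₀D hy)
  have hD' : ∀ y, y ∉ D → y ∈ C ∧ y ∉ B := by
    intro y hy
    refine ⟨(not_le.1 (show ¬ infEDist y Oᶜ ≤ infEDist y A from hy)).le, fun hyB => hy ?_⟩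
    change infEDist y Oᶜ ≤ _
    rw [infEDist_zero_of_mem (show y ∈ Oᶜ from fun h => hOB y h hyB)]
    exact zero_le
  have hDV : ∀ y, y ∉ D → y ∈ V := fun y hy => (hCO y (hD' y hy).1 (hD' y hy).2).1
  set F : Y → X := fun y => if y ∈ D then G y else h (P y) (T y) with hF
  have hFD : ∀ y ∈ D, F y = G y := fun y hy => if_pos hy
  have hFP : ∀ y ∉ D, F y = h (P y) (T y) := fun y hy => if_neg hy
  -- the coordinates of `F` in the mapping cylinder
  have hFS : MapsTo F U S := by
    intro y hy
    by_cases hyD : y ∈ D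
    · rw [hFD y hyD]; exact hKS (hGK hy)
    · rw [hFP y hyD]; exact (hh _ (hPS (hDV y hyD)) _ (hT01 y)).1
  have htF : ∀ y ∈ U, t (F y) = T y := by
    intro y hy
    by_cases hyD : y ∈ D
    · rw [hFD y hyD, hTD y hyD, htK _ (hGK hy)]
    · rw [hFP y hyD, (hh _ (hPS (hDV y hyD)) _ (hT01 y)).2.1]
  have hrF : ∀ y ∈ U, r (F y) = G y := by
    intro y hy
    by_cases hyD : y ∈ D
    · rw [hFD y hyD, hrK _ (hGK hy)]
    · rw [hFP y hyD, (hh _ (hPS (hDV y hyD)) _ (hT01 y)).2.2, hGg (hD' y hyD).1,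
        hgP y (hD' y hyD).2]
  refine ⟨U, hU, hAC.trans hCU, F, ?_, hFS, ?_⟩
  · intro y hy
    by_cases hyD : y ∈ D
    · have hle : Tendsto F (𝓝[U] y) (comap t (𝓝 0) ⊓ comap r (𝓝 (G y)) ⊓ 𝓟 S) := by
        refine tendsto_inf.2 ⟨tendsto_inf.2 ⟨tendsto_comap_iff.2 ?_, tendsto_comap_iff.2 ?_⟩, ?_⟩
        · rw [← hTD y hyD]
          exact (T.continuous.continuousWithinAt).congr' <|
            eventually_mem_nhdsWithin.mono fun z hz => (htF z hz).symm
        · exact (hG y hy).congr' <|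
            eventually_mem_nhdsWithin.mono fun z hz => (hrF z hz).symm
        · exact tendsto_principal.2 (eventually_mem_nhdsWithin.mono fun z hz => hFS hz)
      have := hle.mono_right (hN _ (hGK hy))
      rwa [← hFD y hyD] at this
    · refine ContinuousAt.continuousWithinAt ?_
      have hopen : IsOpen (Dᶜ) := hDc.isOpen_compl
      have hPT : ContinuousOn (fun z => h (P z) (T z)) Dᶜ :=
        hhc.comp ((hP.mono hDV).prodMk T.continuous.continuousOn)
          fun z hz => ⟨hPS (hDV z hz), hT01 z⟩
      refine (hPT.continuousAt (hopen.mem_nhds hyD)).congr ?_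
      filter_upwards [hopen.mem_nhds hyD] with z hz
      exact (hFP z hz).symm
  · intro y hy
    by_cases hyD : y ∈ D
    · have hyB := hAD y hy hyD
      rw [hFD y hyD, hGg (hAC hy), hgB y hyB]
    · have hyB := (hD' y hyD).2
      rw [hFP y hyD, hPf ⟨hy, hyB⟩, hTt' (Or.inl hy), ht₀A hy]
      exact hht _ (hfB ⟨hy, hyB⟩)

/-! ### Attaching a cell -/

section Cell

variable {E : Type*} [NormedAddCommGroup E] [NormedSpace ℝ E] [FiniteDimensional ℝ E]
  {Φ : E → X} {Ψ : X → E}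

lemma isANE_image_ball (hΦ : ContinuousOn Φ (ball 0 1)) (hΨ : ContinuousOn Ψ (Φ '' ball 0 1))
    (hΨΦ : ∀ v ∈ ball (0 : E) 1, Ψ (Φ v) = v) : IsANE (Φ '' ball 0 1) := by
  intro Y _ _ A f hA hf hfS
  have := Metric.instTietzeExtensionBall.{u} (𝕜 := ℝ) (E := E) one_pos
  obtain ⟨g, hg, hgf⟩ := ContinuousMap.exists_forall_mem_restrict_eq hA
    (⟨A.domRestrict (fun y => Ψ (f y)), (hΨ.comp hf hfS).domRestrict⟩ : C(A, E))
    (t := ball 0 1) (by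
      rintro ⟨y, hy⟩
      obtain ⟨v, hv, hvy⟩ := hfS hy
      simp only [ContinuousMap.coe_mk, domRestrict_apply]
      rwa [← hvy, hΨΦ v hv])
  refine ⟨univ, isOpen_univ, subset_univ _, fun y => Φ (g y),
    hΦ.comp g.continuous.continuousOn fun y _ => hg y, fun y _ => mem_image_of_mem Φ (hg y),
    fun y hy => ?_⟩
  have h1 : g y = Ψ (f y) := DFunLike.congr_fun hgf ⟨y, hy⟩
  obtain ⟨v, hv, hvy⟩ := hfS hy
  simp only [h1, ← hvy, hΨΦ v hv]

/-- Attaching a cell to a closed absolute neighbourhood extensor `K` yields another one. Here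
`Φ` is the characteristic map of the cell, and `Ψ` is its inverse on the open cell. The union is
covered by the open cell and by the complement of the centre of the cell, which is a mapping
cylinder neighbourhood of `K`. -/
lemma IsANE.union_image_closedBall [MetrizableSpace X] {K : Set X} (hK : IsClosed K)
    (hKA : IsANE K) (hΦ : ContinuousOn Φ (closedBall 0 1)) (hΨ : ContinuousOn Ψ (Φ '' ball 0 1))
    (hΨΦ : ∀ v ∈ ball (0 : E) 1, Ψ (Φ v) = v) (hsph : MapsTo Φ (sphere 0 1) K)
    (hd : Disjoint (Φ '' ball 0 1) K) : IsANE (K ∪ Φ '' closedBall 0 1) := by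
  classical
  have := FiniteDimensional.proper ℝ E
  have hball : IsANE (Φ '' ball 0 1) := isANE_image_ball (hΦ.mono ball_subset_closedBall) hΨ hΨΦ
  have hdK : ∀ v ∈ ball (0 : E) 1, Φ v ∉ K := fun v hv =>
    Set.disjoint_left.1 hd (mem_image_of_mem Φ hv)
  have hcell : (K ∪ Φ '' closedBall 0 1) ∩ Kᶜ = Φ '' ball 0 1 := by
    ext x
    constructor
    · rintro ⟨hx | ⟨v, hv, rfl⟩, hxK⟩
      · exact absurd hx hxK
      · refine mem_image_of_mem Φ (mem_ball_zero_iff.2 (lt_of_le_of_ne (mem_closedBall_zero_iff.1 hv)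
          fun h => hxK (hsph (mem_sphere_zero_iff_norm.2 h))))
    · rintro ⟨v, hv, rfl⟩
      exact ⟨Or.inr (mem_image_of_mem Φ (ball_subset_closedBall hv)), hdK v hv⟩
  have h0 : (0 : E) ∈ ball (0 : E) 1 := mem_ball_self one_pos
  refine IsANE.of_isOpen_cover (O₁ := {Φ 0}ᶜ) (O₂ := Kᶜ) isOpen_compl_singleton hK.isOpen_compl
    ?_ ?_ (by rwa [hcell])
  · intro x _
    by_cases hx : x = Φ 0
    · exact Or.inr (hx ▸ hdK 0 h0)
    · exact Or.inl hx
  set S : Set X := (K ∪ Φ '' closedBall 0 1) ∩ {Φ 0}ᶜ with hS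
  have hSKeq : S \ K = Φ '' ball 0 1 ∩ {Φ 0}ᶜ := by
    rw [← hcell]
    ext x
    simp only [hS, Set.mem_sdiff, mem_inter_iff, mem_compl_iff]
    tauto
  -- polar coordinates on the punctured open cell
  have hpt : ∀ v ∈ ball (0 : E) 1, v ≠ 0 → Φ v ∈ S \ K := fun v hv hv0 => by
    rw [hSKeq]
    refine ⟨mem_image_of_mem Φ hv, fun h => hv0 ?_⟩
    rw [← hΨΦ v hv, mem_singleton_iff.1 h, hΨΦ 0 h0]
  have hΨS : ∀ x ∈ S \ K, Ψ x ∈ ball (0 : E) 1 ∧ Ψ x ≠ 0 ∧ Φ (Ψ x) = x := fun x hx => by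
    rw [hSKeq] at hx
    obtain ⟨⟨v, hv, rfl⟩, hne⟩ := hx
    rw [hΨΦ v hv]
    exact ⟨hv, fun h => hne (by rw [h]; rfl), rfl⟩
  have hΨc : ContinuousOn Ψ (S \ K) := hΨ.mono (hSKeq ▸ inter_subset_left)
  have hnc : ContinuousOn (fun x => ‖Ψ x‖⁻¹ • Ψ x) (S \ K) :=
    (hΨc.norm.inv₀ fun x hx => norm_ne_zero_iff.2 (hΨS x hx).2.1).smul hΨc
  have hn1 : ∀ x ∈ S \ K, ‖‖Ψ x‖⁻¹ • Ψ x‖ = 1 := fun x hx => by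
    rw [norm_smul, norm_inv, norm_norm, inv_mul_cancel₀ (norm_ne_zero_iff.2 (hΨS x hx).2.1)]
  set t : X → ℝ := fun x => if x ∈ K then 0 else 1 - ‖Ψ x‖ with ht
  set r : X → X := fun x => if x ∈ K then x else Φ (‖Ψ x‖⁻¹ • Ψ x) with hr
  have htK : ∀ x ∈ K, t x = 0 := fun x hx => if_pos hx
  have hrK : ∀ x ∈ K, r x = x := fun x hx => if_pos hx
  have htS : ∀ x ∈ S \ K, t x = 1 - ‖Ψ x‖ := fun x hx => if_neg hx.2
  have hrS : ∀ x ∈ S \ K, r x = Φ (‖Ψ x‖⁻¹ • Ψ x) := fun x hx => if_neg hx.2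
  -- an ultrafilter on the punctured open cell converges to the image of a point of the ball
  have hlim : ∀ l : Ultrafilter X, S \ K ∈ l →
      ∃ v ∈ closedBall (0 : E) 1, Tendsto Ψ l (𝓝 v) ∧ (l : Filter X) ≤ 𝓝 (Φ v) := by
    intro l hl
    have hmem : ∀ᶠ x in l, Ψ x ∈ closedBall (0 : E) 1 :=
      mem_of_superset hl fun x hx => ball_subset_closedBall (hΨS x hx).1
    obtain ⟨v, hv, hlv⟩ := (isCompact_closedBall (0 : E) 1).ultrafilter_le_nhds (l.map Ψ)
      (le_principal_iff.2 hmem)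
    have hΨv : Tendsto Ψ l (𝓝 v) := hlv
    refine ⟨v, hv, hΨv, ?_⟩
    have h1 : Tendsto (fun x => Φ (Ψ x)) l (𝓝 (Φ v)) :=
      (hΦ v hv).tendsto.comp (tendsto_nhdsWithin_iff.2 ⟨hΨv, hmem⟩)
    exact h1.congr' (mem_of_superset hl fun x hx => (hΨS x hx).2.2)
  have hlimt : ∀ (l : Ultrafilter X) (v : E), S \ K ∈ l → Tendsto Ψ l (𝓝 v) →
      Tendsto t l (𝓝 (1 - ‖v‖)) := fun l v hl hv =>
    (tendsto_const_nhds.sub hv.norm).congr' (mem_of_superset hl fun x hx => (htS x hx).symm)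
  have hlimr : ∀ (l : Ultrafilter X) (v : E), S \ K ∈ l → Tendsto Ψ l (𝓝 v) → ‖v‖ = 1 →
      Tendsto r l (𝓝 (Φ v)) := by
    intro l v hl hv hv1
    have h1 : Tendsto (fun x => ‖Ψ x‖⁻¹ • Ψ x) l (𝓝 v) := by
      have := (hv.norm.inv₀ (by simp [hv1])).smul hv
      rwa [hv1, inv_one, one_smul] at this
    have h2 : Tendsto (fun x => Φ (‖Ψ x‖⁻¹ • Ψ x)) l (𝓝 (Φ v)) :=
      (hΦ v (by simp [hv1])).tendsto.comp (tendsto_nhdsWithin_iff.2 ⟨h1,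
        mem_of_superset hl fun x hx => mem_closedBall_zero_iff.2 (hn1 x hx).le⟩)
    exact h2.congr' (mem_of_superset hl fun x hx => (hrS x hx).symm)
  -- near `K` the coordinates `t` and `r` are continuous
  have hlimK : ∀ k ∈ K, Tendsto t (𝓝[S] k) (𝓝 0) ∧ Tendsto r (𝓝[S] k) (𝓝 k) := by
    intro k hk
    rw [tendsto_iff_ultrafilter, tendsto_iff_ultrafilter, ← forall_and]
    intro l
    rw [← forall_and]
    intro hl
    have hlk : (l : Filter X) ≤ 𝓝 k := hl.trans nhdsWithin_le_nhds
    by_cases hKl : K ∈ l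
    · exact ⟨tendsto_const_nhds.congr' (mem_of_superset hKl fun x hx => (htK x hx).symm),
        (tendsto_id'.2 hlk).congr' (mem_of_superset hKl fun x hx => (hrK x hx).symm)⟩
    · have hSl : S \ K ∈ l :=
        inter_mem (hl self_mem_nhdsWithin) (Ultrafilter.compl_mem_iff_notMem.2 hKl)
      obtain ⟨v, hv, hΨv, hlv⟩ := hlim l hSl
      have hvk : Φ v = k := tendsto_nhds_unique (tendsto_id'.2 hlv) (tendsto_id'.2 hlk)
      have hv1 : ‖v‖ = 1 := by
        refine le_antisymm (mem_closedBall_zero_iff.1 hv) (not_lt.1 fun h => ?_)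
        exact hdK v (mem_ball_zero_iff.2 h) (hvk ▸ hk)
      have h1 := hlimt l v hSl hΨv
      rw [hv1, sub_self] at h1
      exact ⟨h1, hvk ▸ hlimr l v hSl hΨv hv1⟩
  have hnear : ∀ x ∉ K, S \ K ∈ 𝓝[S] x := fun x hxK =>
    inter_mem self_mem_nhdsWithin (mem_nhdsWithin_of_mem_nhds (hK.isOpen_compl.mem_nhds hxK))
  have hτ : ∀ x ∈ S \ K, ∀ τ ∈ Ico (0 : ℝ) 1, ‖(1 - τ) • ‖Ψ x‖⁻¹ • Ψ x‖ = 1 - τ :=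
    fun x hx τ hτ => by
      rw [norm_smul, hn1 x hx, mul_one, Real.norm_of_nonneg (by linarith [hτ.2])]
  have hrSK : ∀ x ∈ S \ K, r x ∈ K := fun x hx => by
    rw [hrS x hx]
    exact hsph (mem_sphere_zero_iff_norm.2 (hn1 x hx))
  have hKS : K ⊆ S := fun x hx => ⟨Or.inl hx, fun h => hdK 0 h0 (mem_singleton_iff.1 h ▸ hx)⟩
  refine IsANE.of_mappingCylinder (t := t) (r := r)
    (h := fun x τ => Φ ((1 - τ) • ‖Ψ x‖⁻¹ • Ψ x)) hK hKS hKA ?_ ?_ ?_ ?_ ?_ htK ?_ hrK ?_ ?_ ?_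
  · rw [hSKeq]
    exact hball.inter_isOpen isOpen_compl_singleton
  · intro x hx
    by_cases hxK : x ∈ K
    · have := (hlimK x hxK).1
      rwa [← htK x hxK] at this
    · exact ((continuousOn_const.sub hΨc.norm).congr htS x ⟨hx, hxK⟩).mono_of_mem_nhdsWithin
        (hnear x hxK)
  · intro x hx
    by_cases hxK : x ∈ K
    · have := (hlimK x hxK).2
      unfold ContinuousWithinAt
      rwa [hrK x hxK]
    · refine (ContinuousOn.congr (hΦ.comp hnc fun z hz => ?_) hrS x
        ⟨hx, hxK⟩).mono_of_mem_nhdsWithin (hnear x hxK)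
      exact mem_closedBall_zero_iff.2 (hn1 z hz).le
  · refine hΦ.comp (f := fun p : X × ℝ => (1 - p.2) • ‖Ψ p.1‖⁻¹ • Ψ p.1) ?_ ?_
    · exact (continuous_const.sub continuous_snd).continuousOn.smul
        (hnc.comp continuous_fst.continuousOn fun p hp => hp.1)
    · rintro ⟨x, τ⟩ ⟨hx, hτ1⟩
      rw [mem_closedBall_zero_iff, hτ x hx τ hτ1]
      linarith [hτ1.1]
  · intro x hx
    by_cases hxK : x ∈ K
    · rw [htK x hxK]; simp
    · obtain ⟨h1, h2, -⟩ := hΨS x ⟨hx, hxK⟩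
      rw [htS x ⟨hx, hxK⟩]
      have := norm_pos_iff.2 h2
      have := mem_ball_zero_iff.1 h1
      constructor <;> linarith
  · intro x hx
    by_cases hxK : x ∈ K
    · rwa [hrK x hxK]
    · exact hrSK x ⟨hx, hxK⟩
  · intro x hx τ hτ1
    have hnorm := hτ x hx τ hτ1
    set w := (1 - τ) • ‖Ψ x‖⁻¹ • Ψ x with hw
    have hw0 : w ≠ 0 := norm_ne_zero_iff.1 (by rw [hnorm]; linarith [hτ1.2])
    rcases hτ1.1.eq_or_lt with h | h
    · -- height `0`: the end point of the ray, which lies in `K`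
      have hwx : Φ w = r x := by
        rw [hrS x hx, hw, ← h, sub_zero, one_smul]
      change Φ w ∈ S ∧ t (Φ w) = τ ∧ r (Φ w) = r x
      rw [hwx, htK _ (hrSK x hx), hrK _ (hrSK x hx)]
      exact ⟨hKS (hrSK x hx), h, rfl⟩
    · have hwb : w ∈ ball (0 : E) 1 := mem_ball_zero_iff.2 (by rw [hnorm]; linarith)
      have hwS := hpt w hwb hw0
      refine ⟨hwS.1, ?_, ?_⟩
      · rw [htS _ hwS, hΨΦ w hwb, hnorm]
        ring
      · rw [hrS _ hwS, hrS _ hx, hΨΦ w hwb, hnorm, hw, smul_smul,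
          inv_mul_cancel₀ (by linarith [hτ1.2]), one_smul]
  · intro x hx
    obtain ⟨-, h2, h3⟩ := hΨS x hx
    simp only [htS x hx]
    rw [sub_sub_cancel, smul_smul, mul_inv_cancel₀ (norm_ne_zero_iff.2 h2), one_smul, h3]
  · intro k hk
    rw [le_iff_ultrafilter]
    intro l hl
    obtain ⟨hl12, hlS⟩ := le_inf_iff.1 hl
    obtain ⟨hl1, hl2⟩ := le_inf_iff.1 hl12
    have hlt : Tendsto t l (𝓝 0) := tendsto_iff_comap.2 hl1
    have hlr : Tendsto r l (𝓝 k) := tendsto_iff_comap.2 hl2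
    by_cases hKl : K ∈ l
    · exact tendsto_id'.1 (hlr.congr' (mem_of_superset hKl fun x hx => hrK x hx))
    · have hSl : S \ K ∈ l :=
        inter_mem (le_principal_iff.1 hlS) (Ultrafilter.compl_mem_iff_notMem.2 hKl)
      obtain ⟨v, hv, hΨv, hlv⟩ := hlim l hSl
      have hv1 : ‖v‖ = 1 := by
        have := tendsto_nhds_unique hlt (hlimt l v hSl hΨv)
        linarith
      rwa [tendsto_nhds_unique hlr (hlimr l v hSl hΨv hv1)]

end Cell

/-! ### Finite subcomplexes -/

section Finite

open Topology.RelCWComplex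

variable {C : Set X} [CWComplex C]

/-- A finite set of cells of a CW complex is the set of cells of a subcomplex if the frontier of
each of its cells is covered by its cells of lower dimension. -/
def IsCellClosed (F : Finset (Σ n, cell C n)) : Prop :=
  ∀ c ∈ F, cellFrontier c.1 c.2 ⊆ ⋃ d ∈ F, ⋃ (_ : d.1 < c.1), closedCell d.1 d.2

/-- The union of the closed cells in a finite set of cells. -/
def cellUnion (F : Finset (Σ n, cell C n)) : Set X := ⋃ c ∈ F, closedCell c.1 c.2

lemma isClosed_cellUnion [T2Space X] (F : Finset (Σ n, cell C n)) : IsClosed (cellUnion F) :=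
  F.finite_toSet.isClosed_biUnion fun _ _ => isClosed_closedCell

lemma exists_isCellClosed_superset (F : Finset (Σ n, cell C n)) :
    ∃ F' : Finset (Σ n, cell C n), F ⊆ F' ∧ IsCellClosed F' := by
  classical
  suffices h : ∀ (N : ℕ) (F : Finset (Σ n, cell C n)), (∀ c ∈ F, c.1 < N) →
      ∃ F' : Finset (Σ n, cell C n), F ⊆ F' ∧ IsCellClosed F' from
    h (F.sup Sigma.fst + 1) F fun c hc => Nat.lt_succ_of_le (Finset.le_sup (f := Sigma.fst) hc)
  intro N
  induction N with
  | zero =>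
    intro F hF
    obtain rfl : F = ∅ := Finset.eq_empty_of_forall_notMem fun c hc => absurd (hF c hc) (by simp)
    exact ⟨∅, subset_rfl, by simp [IsCellClosed]⟩
  | succ N ih =>
    intro F hF
    choose I hI using fun c : Σ n, cell C n =>
      CWComplex.cellFrontier_subset_finite_closedCell c.1 c.2
    obtain ⟨G, hG, hGc⟩ := ih (F.biUnion fun c => (Finset.range c.1).sigma (I c)) (by
      intro d hd
      obtain ⟨c, hc, hdc⟩ := Finset.mem_biUnion.1 hd
      have h1 := Finset.mem_range.1 (Finset.mem_sigma.1 hdc).1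
      have h2 := hF c hc
      lia)
    refine ⟨F ∪ G, Finset.subset_union_left, fun c hc => ?_⟩
    rcases Finset.mem_union.1 hc with hc | hc
    · intro x hx
      have hx' := hI c hx
      simp only [mem_iUnion] at hx' ⊢
      obtain ⟨m, hm, j, hj, hxj⟩ := hx'
      exact ⟨⟨m, j⟩, Finset.mem_union_right F (hG (Finset.mem_biUnion.2
        ⟨c, hc, Finset.mem_sigma.2 ⟨Finset.mem_range.2 hm, hj⟩⟩)), hm, hxj⟩
    · exact (hGc c hc).trans (biUnion_subset_biUnion_left fun d hd => Finset.mem_union_right F hd)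

lemma IsCellClosed.disjoint_openCell {F : Finset (Σ n, cell C n)} (hF : IsCellClosed F)
    {c : Σ n, cell C n} (hc : c ∉ F) : Disjoint (openCell c.1 c.2) (cellUnion F) := by
  suffices h : ∀ (N : ℕ), ∀ d ∈ F, d.1 = N → Disjoint (openCell c.1 c.2) (closedCell d.1 d.2) by
    simp only [cellUnion, disjoint_iUnion_right]
    exact fun d hd => h d.1 d hd rfl
  intro N
  induction N using Nat.strong_induction_on with
  | _ N ih =>
    rintro d hd rfl
    rw [← cellFrontier_union_openCell_eq_closedCell, disjoint_union_right]
    refine ⟨Disjoint.mono_right (hF d hd) ?_,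
      disjoint_openCell_of_ne fun h => hc ((show c = d from h) ▸ hd)⟩
    simp only [disjoint_iUnion_right]
    exact fun e he hed => ih e.1 hed e he rfl

lemma isANE_empty : IsANE (∅ : Set X) := fun _ _ _ _ f _ _ hf =>
  ⟨∅, isOpen_empty, fun _ hy => hf hy, f, continuousOn_empty f, mapsTo_empty f _,
    fun _ hy => (hf hy).elim⟩

/-- Finite subcomplexes are absolute neighbourhood extensors, as they are built by attaching one
cell at a time. -/
lemma IsCellClosed.isANE_cellUnion [MetrizableSpace X] (F : Finset (Σ n, cell C n))
    (hF : IsCellClosed F) : IsANE (cellUnion F) := by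
  classical
  induction F using Finset.strongInduction with
  | H F ih =>
    rcases F.eq_empty_or_nonempty with rfl | hne
    · simpa [cellUnion] using isANE_empty
    -- a cell of maximal dimension is attached to the union of the others
    obtain ⟨c, hc, hmax⟩ := F.exists_max_image Sigma.fst hne
    have herase : ∀ d ∈ F, cellFrontier d.1 d.2 ⊆
        ⋃ e ∈ F.erase c, ⋃ (_ : e.1 < d.1), closedCell e.1 e.2 := by
      intro d hd x hx
      have hx' := hF d hd hx
      simp only [mem_iUnion] at hx' ⊢
      obtain ⟨e, he, hed, hxe⟩ := hx'
      refine ⟨e, Finset.mem_erase.2 ⟨?_, he⟩, hed, hxe⟩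
      rintro rfl
      exact absurd (hmax d hd) (not_le.2 hed)
    have hF' : IsCellClosed (F.erase c) := fun d hd => herase d (Finset.mem_of_mem_erase hd)
    have hunion : cellUnion F = cellUnion (F.erase c) ∪ map c.1 c.2 '' closedBall 0 1 := by
      conv_lhs => rw [← Finset.insert_erase hc]
      simp only [cellUnion, Finset.set_biUnion_insert]
      exact union_comm _ _
    have htarget : map c.1 c.2 '' ball 0 1 = (map c.1 c.2).target := by
      rw [← source_eq c.1 c.2, PartialEquiv.image_source_eq_target]
    rw [hunion]
    refine (ih _ (Finset.erase_ssubset hc) hF').union_image_closedBall (Ψ := (map c.1 c.2).symm)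
      (isClosed_cellUnion _) (continuousOn c.1 c.2) ?_ ?_ ?_ ?_
    · rw [htarget]
      exact continuousOn_symm c.1 c.2
    · intro v hv
      exact (map c.1 c.2).left_inv (by rwa [source_eq])
    · intro v hv
      refine (herase c hc).trans ?_ (mem_image_of_mem _ hv)
      exact iUnion₂_mono fun e _ => iUnion_subset fun _ => subset_rfl
    · exact hF'.disjoint_openCell (Finset.notMem_erase c F)

end Finite

/-! ### Locally finite complexes -/

/-- A Hausdorff space covered by a locally finite countable family of images of compact second
countable spaces is second countable. The family assembles to a closed map with compact fibres from
the disjoint union; the sets of points whose whole fibre lies in a given finite union of basic open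
sets form a basis. -/
lemma secondCountableTopology_of_locallyFinite [T2Space X] {ι : Type*} [Countable ι]
    {Z : ι → Type*} [∀ i, TopologicalSpace (Z i)] [∀ i, CompactSpace (Z i)]
    [∀ i, SecondCountableTopology (Z i)] {p : ∀ i, Z i → X} (hp : ∀ i, Continuous (p i))
    (hlf : LocallyFinite fun i => range (p i)) (hcov : ∀ x, ∃ i z, p i z = x) :
    SecondCountableTopology X := by
  set q : (Σ i, Z i) → X := fun z => p z.1 z.2 with hq
  have hqc : Continuous q := continuous_sigma hp
  have hclosed : IsClosedMap q := by
    intro s hs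
    have : q '' s = ⋃ i, p i '' (Sigma.mk i ⁻¹' s) := by
      ext x
      simp only [mem_image, mem_iUnion, mem_preimage, Sigma.exists, hq]
    rw [this]
    exact (hlf.subset fun i => image_subset_range _ _).isClosed_iUnion fun i =>
      ((hs.preimage continuous_sigmaMk).isCompact.image (hp i)).isClosed
  have hfib : ∀ x, IsCompact (q ⁻¹' {x}) := by
    intro x
    have : q ⁻¹' {x} = ⋃ i ∈ {i | x ∈ range (p i)}, Sigma.mk i '' (p i ⁻¹' {x}) := by
      ext ⟨i, z⟩
      simp only [mem_preimage, mem_singleton_iff, mem_iUnion, mem_image, hq, mem_ofPred_eq,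
        exists_prop]
      constructor
      · exact fun h => ⟨i, ⟨z, h⟩, z, h, rfl⟩
      · rintro ⟨j, -, w, hw, heq⟩
        cases heq
        exact hw
    rw [this]
    exact (hlf.point_finite x).isCompact_biUnion fun i _ =>
      (((isClosed_singleton.preimage (hp i)).isCompact).image continuous_sigmaMk)
  set b := countableBasis (Σ i, Z i) with hb
  have hbb : IsTopologicalBasis b := isBasis_countableBasis _
  set β : Set (Set X) := (fun T : Set (Set (Σ i, Z i)) => (q '' (⋃₀ T)ᶜ)ᶜ) '' {T | T.Finite ∧ T ⊆ b}
    with hβ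
  have hβb : IsTopologicalBasis β := by
    refine isTopologicalBasis_of_isOpen_of_nhds ?_ ?_
    · rintro _ ⟨T, ⟨-, hT⟩, rfl⟩
      exact (hclosed _ (isOpen_sUnion fun s hs => hbb.isOpen (hT hs)).isClosed_compl).isOpen_compl
    · intro x O hx hO
      have hcover : ∀ z ∈ q ⁻¹' {x}, ∃ s ∈ b, z ∈ s ∧ s ⊆ q ⁻¹' O := fun z hz =>
        hbb.exists_subset_of_mem_open (show z ∈ q ⁻¹' O by
          rw [mem_preimage, mem_singleton_iff.1 hz]; exact hx) (hO.preimage hqc)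
      obtain ⟨T, hT, hTfin, hxT⟩ := (hfib x).elim_finite_subcover_image
        (b := {s | s ∈ b ∧ s ⊆ q ⁻¹' O}) (c := id) (fun s hs => hbb.isOpen hs.1) (fun z hz => by
          obtain ⟨s, hs, hzs, hsO⟩ := hcover z hz
          exact mem_biUnion (show s ∈ {s | s ∈ b ∧ s ⊆ q ⁻¹' O} from ⟨hs, hsO⟩) hzs)
      refine ⟨_, ⟨T, ⟨hTfin, fun s hs => (hT hs).1⟩, rfl⟩, ?_, ?_⟩
      · rintro ⟨z, hz, hzx⟩
        refine hz ?_
        rw [sUnion_eq_biUnion]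
        exact hxT hzx
      · intro y hy
        obtain ⟨i, z, hz⟩ := hcov y
        by_contra hyO
        refine hy ⟨⟨i, z⟩, ?_, hz⟩
        rintro ⟨s, hs, hzs⟩
        have : p i z ∈ O := (hT hs).2 hzs
        exact hyO (hz ▸ this)
  exact hβb.secondCountableTopology
    ((countable_ofPred_finite_subset (countable_countableBasis _)).image _)

section LocallyFinite

open Topology.RelCWComplex

variable [CWComplex (univ : Set X)]

lemma exists_mem_closedCell (x : X) : ∃ c : Σ n, cell (univ : Set X) n, x ∈ closedCell c.1 c.2 := by
  have hx : x ∈ ⋃ (n : ℕ) (j : cell (univ : Set X) n), closedCell n j := by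
    rw [CWComplex.union]
    exact mem_univ x
  obtain ⟨n, j, hj⟩ := by simpa only [mem_iUnion] using hx
  exact ⟨⟨n, j⟩, hj⟩

lemma IsLocallyFiniteCW.weaklyLocallyCompactSpace (hlf : IsLocallyFiniteCW (univ : Set X)) :
    WeaklyLocallyCompactSpace X := by
  refine ⟨fun x => ?_⟩
  obtain ⟨U, hU, hfin⟩ := hlf x
  refine ⟨_, hfin.isCompact_biUnion fun c _ => isCompact_closedCell (n := c.1) (i := c.2),
    mem_of_superset hU fun y hy => ?_⟩
  obtain ⟨c, hc⟩ := exists_mem_closedCell y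
  exact mem_biUnion (show c ∈ {c | _} from ⟨y, hc, hy⟩) hc

variable [T2Space X]

/-- A connected locally finite complex has countably many cells: each closed cell meets finitely
many others, and the cells reached from a given one through chains of such intersections cover a
clopen set. -/
lemma IsLocallyFiniteCW.countable_cells [ConnectedSpace X]
    (hlf : IsLocallyFiniteCW (univ : Set X)) : Countable (Σ n, cell (univ : Set X) n) := by
  obtain ⟨c₀, -⟩ := exists_mem_closedCell (Classical.arbitrary X)
  set N : (Σ n, cell (univ : Set X) n) → Set (Σ n, cell (univ : Set X) n) := fun c =>
    {d | (closedCell d.1 d.2 ∩ closedCell c.1 c.2).Nonempty} with hN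
  have hNfin : ∀ c, (N c).Finite := fun c => hlf.finite_nonempty_inter_compact isCompact_closedCell
  set R : ℕ → Set (Σ n, cell (univ : Set X) n) := fun k =>
    Nat.rec {c₀} (fun _ s => ⋃ c ∈ s, N c) k with hR
  have hRc : ∀ k, (R k).Countable := by
    intro k
    induction k with
    | zero => exact countable_singleton c₀
    | succ k ih => exact ih.biUnion fun c _ => (hNfin c).countable
  set T := ⋃ k, R k with hT
  have hTN : ∀ c ∈ T, ∀ d ∈ N c, d ∈ T := by
    intro c hc d hd
    obtain ⟨k, hk⟩ := mem_iUnion.1 hc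
    exact mem_iUnion.2 ⟨k + 1, mem_biUnion hk hd⟩
  have hclosed : ∀ s : Set (Σ n, cell (univ : Set X) n),
      IsClosed (⋃ c : s, closedCell c.1.1 c.1.2) := fun s =>
    LocallyFinite.isClosed_iUnion (hlf.comp_injective Subtype.val_injective)
      fun _ => isClosed_closedCell
  have hcompl : (⋃ c : T, closedCell c.1.1 c.1.2)ᶜ =
      ⋃ c : (Tᶜ : Set (Σ n, cell (univ : Set X) n)), closedCell c.1.1 c.1.2 := by
    ext x
    simp only [mem_compl_iff, mem_iUnion, not_exists]
    constructor
    · intro h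
      obtain ⟨c, hc⟩ := exists_mem_closedCell x
      exact ⟨⟨c, fun hcT => h ⟨c, hcT⟩ hc⟩, hc⟩
    · rintro ⟨⟨c, hcT⟩, hc⟩ ⟨d, hdT⟩ hd
      exact hcT (hTN d hdT c ⟨x, hc, hd⟩)
  have hclopen : IsClopen (⋃ c : T, closedCell c.1.1 c.1.2) :=
    ⟨hclosed T, isClosed_compl_iff.1 (hcompl ▸ hclosed Tᶜ)⟩
  have huniv : (⋃ c : T, closedCell c.1.1 c.1.2) = univ := by
    refine hclopen.eq_univ ?_
    obtain ⟨x, hx⟩ := closedCell_nonempty (C := (univ : Set X)) c₀.1 c₀.2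
    exact ⟨x, mem_iUnion.2 ⟨⟨c₀, mem_iUnion.2 ⟨0, rfl⟩⟩, hx⟩⟩
  have hTuniv : T = univ := by
    refine eq_univ_of_forall fun c => ?_
    obtain ⟨x, hx⟩ := closedCell_nonempty (C := (univ : Set X)) c.1 c.2
    obtain ⟨⟨d, hdT⟩, hd⟩ := mem_iUnion.1 (huniv ▸ mem_univ x)
    exact hTN d hdT c ⟨x, hx, hd⟩
  exact countable_univ_iff.1 (hTuniv ▸ countable_iUnion hRc)

lemma IsLocallyFiniteCW.secondCountableTopology [ConnectedSpace X]
    (hlf : IsLocallyFiniteCW (univ : Set X)) : SecondCountableTopology X := by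
  have := hlf.countable_cells
  have hrange : ∀ c : Σ n, cell (univ : Set X) n,
      range (fun z : closedBall (0 : Fin c.1 → ℝ) 1 => map c.1 c.2 z) = closedCell c.1 c.2 :=
    fun c => by rw [closedCell, image_eq_range]
  refine secondCountableTopology_of_locallyFinite (ι := Σ n, cell (univ : Set X) n)
    (Z := fun c => closedBall (0 : Fin c.1 → ℝ) 1) (p := fun c z => map c.1 c.2 z)
    (fun c => (continuousOn c.1 c.2).domRestrict) ?_ fun x => ?_
  · simp only [hrange]
    exact hlf
  · obtain ⟨c, v, hv, hvx⟩ := exists_mem_closedCell x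
    exact ⟨c, ⟨v, hv⟩, hvx⟩

lemma IsLocallyFiniteCW.metrizableSpace [ConnectedSpace X]
    (hlf : IsLocallyFiniteCW (univ : Set X)) : MetrizableSpace X := by
  have := hlf.weaklyLocallyCompactSpace
  have := hlf.secondCountableTopology
  exact metrizableSpace_of_t3_secondCountable X

lemma IsLocallyFiniteCW.isANE_univ [ConnectedSpace X]
    (hlf : IsLocallyFiniteCW (univ : Set X)) : IsANE (univ : Set X) := by
  have := hlf.weaklyLocallyCompactSpace
  have := hlf.secondCountableTopology
  have := hlf.metrizableSpace
  set K := CompactExhaustion.choice X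
  refine isANE_univ_of_compactExhaustion K fun n => ?_
  obtain ⟨F, hF, hFc⟩ := exists_isCellClosed_superset
    (hlf.finite_nonempty_inter_compact (K.isCompact n)).toFinset
  have : interior (K n) = cellUnion F ∩ interior (K n) := by
    refine (inter_eq_right.2 fun x hx => ?_).symm
    obtain ⟨c, hc⟩ := exists_mem_closedCell x
    refine mem_biUnion (hF ?_) hc
    rw [Set.Finite.mem_toFinset]
    exact ⟨x, hc, interior_subset hx⟩
  rw [this]
  exact (hFc.isANE_cellUnion F).inter_isOpen isOpen_interior

end LocallyFinite

/-! ### Extension of maps into contractible spaces -/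

/-- A contractible absolute neighbourhood extensor is an absolute extensor: the extension to a
neighbourhood is contracted to a point away from `A`. -/
lemma IsANE.exists_continuous_eqOn [ContractibleSpace X] (hX : IsANE (univ : Set X)) {Y : Type u}
    [TopologicalSpace Y] [MetrizableSpace Y] {A : Set Y} {f : Y → X} (hA : IsClosed A)
    (hf : ContinuousOn f A) : ∃ g : Y → X, Continuous g ∧ EqOn g f A := by
  classical
  obtain ⟨U, hU, hAU, F, hF, -, hFf⟩ := hX Y A f hA hf (mapsTo_univ f A)
  obtain ⟨x₀, ⟨H⟩⟩ := id_nullhomotopic X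
  obtain ⟨V, hV, hAV, hVU⟩ := normal_exists_closure_subset hA hU hAU
  obtain ⟨l, hl0, hl1, hl⟩ := exists_continuous_zero_one_of_isClosed hA hV.isClosed_compl
    (disjoint_compl_right_iff_subset.2 hAV)
  set m : Y → unitInterval := fun y => ⟨l y, hl y⟩ with hm
  have hmc : Continuous m := l.continuous.subtype_mk _
  have hm1 : ∀ y ∉ V, m y = 1 := fun y hy => Subtype.ext (hl1 hy)
  set g : Y → X := fun y => if y ∈ V then H (m y, F y) else x₀ with hg
  have hgU : EqOn g (fun y => H (m y, F y)) U := by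
    intro y _
    by_cases hy : y ∈ V
    · exact if_pos hy
    · simp [hg, hy, hm1 y hy]
  refine ⟨g, continuous_iff_continuousAt.2 fun y => ?_, fun y hy => ?_⟩
  · by_cases hy : y ∈ U
    · have hc : ContinuousOn (fun y => H (m y, F y)) U :=
        H.continuous.comp_continuousOn (hmc.continuousOn.prodMk hF)
      exact (hc.congr hgU).continuousAt (hU.mem_nhds hy)
    · refine (continuousAt_const (y := x₀)).congr ?_
      filter_upwards [isClosed_closure.isOpen_compl.mem_nhds fun h => hy (hVU h)] with z hz
      exact (if_neg fun h => hz (subset_closure h)).symm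
  · have h0 : m y = 0 := Subtype.ext (hl0 hy)
    rw [hgU (hAU hy)]
    simp [h0, hFf hy]

/-! ### The majority function on tuples with a majority -/

/-- Two strict majorities share a member. -/
lemma eq_of_lt_two_mul_ncard {α : Type*} {n : ℕ} {x : Fin n → α} {y z : α}
    (hy : n < 2 * {i : Fin n | x i = y}.ncard) (hz : n < 2 * {i : Fin n | x i = z}.ncard) :
    y = z := by
  by_contra hyz
  have hd : Disjoint {i : Fin n | x i = y} {i : Fin n | x i = z} :=
    Set.disjoint_left.2 fun i hi hi' => hyz (hi.symm.trans hi')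
  have h1 := ncard_union_eq hd
  have h2 := ncard_le_card ({i : Fin n | x i = y} ∪ {i : Fin n | x i = z})
  rw [Nat.card_fin] at h2
  lia

/-- On the closed set of tuples with a majority value, that value depends continuously on the tuple:
the set is the finite union, over the majorities `s` of agents, of the closed sets of tuples that
are constant on `s`. -/
lemma exists_continuousOn_majority [T2Space X] [Nonempty X] (n : ℕ) :
    ∃ (A : Set (Fin n → X)) (f : (Fin n → X) → X), IsClosed A ∧ ContinuousOn f A ∧
      ∀ (x : Fin n → X) (y : X), n < 2 * {i : Fin n | x i = y}.ncard → x ∈ A ∧ f x = y := by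
  classical
  set f : (Fin n → X) → X := fun x =>
    if h : ∃ y, n < 2 * {i : Fin n | x i = y}.ncard then h.choose else Classical.arbitrary X
  have hf : ∀ (x : Fin n → X) (y : X), n < 2 * {i : Fin n | x i = y}.ncard → f x = y := by
    intro x y hy
    have h : ∃ y, n < 2 * {i : Fin n | x i = y}.ncard := ⟨y, hy⟩
    have hfx : f x = h.choose := dif_pos h
    rw [hfx]
    exact eq_of_lt_two_mul_ncard h.choose_spec hy
  set A : {s : Finset (Fin n) // n < 2 * s.card} → Set (Fin n → X) := fun s =>
    {x | ∀ i ∈ s.1, ∀ j ∈ s.1, x i = x j} with hA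
  have hAc : ∀ s, IsClosed (A s) := by
    intro s
    simp only [hA, ofPred_forall]
    exact isClosed_iInter fun i => isClosed_iInter fun _ => isClosed_iInter fun j =>
      isClosed_iInter fun _ => isClosed_eq (continuous_apply i) (continuous_apply j)
  have hfA : ∀ s, ContinuousOn f (A s) := by
    intro s
    obtain ⟨i, hi⟩ : s.1.Nonempty := Finset.card_pos.1 (by have := s.2; lia)
    refine (continuous_apply i).continuousOn.congr fun x hx => hf x (x i) ?_
    have hsub : (s.1 : Set (Fin n)) ⊆ {j | x j = x i} := fun j hj => hx j hj i hi
    have := ncard_le_ncard hsub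
    rw [ncard_coe_finset] at this
    have := s.2
    lia
  refine ⟨⋃ s, A s, f, isClosed_iUnion_of_finite hAc,
    (locallyFinite_of_finite A).continuousOn_iUnion hAc hfA, fun x y hy => ⟨?_, hf x y hy⟩⟩
  refine mem_iUnion.2 ⟨⟨Finset.univ.filter fun i => x i = y, ?_⟩, fun i hi j hj => ?_⟩
  · rw [← ncard_coe_finset]
    simpa using hy
  · simp only [Finset.mem_filter, Finset.mem_univ, true_and] at hi hj
    rw [hi, hj]

end MajorityChoice

theorem mainTheorem3 {X : Type*} [TopologicalSpace X] [T2Space X]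
    [Topology.CWComplex (Set.univ : Set X)]
    (hlf : MajorityChoice.IsLocallyFiniteCW (Set.univ : Set X))
    [ConnectedSpace X] [ContractibleSpace X] (n : ℕ) :
    ∃ M : (Fin n → X) → X, MajorityChoice.IsMajorityFunction M := by
  have := hlf.metrizableSpace
  obtain ⟨A, f, hA, hf, hmaj⟩ := MajorityChoice.exists_continuousOn_majority (X := X) n
  obtain ⟨M, hM, hMf⟩ := hlf.isANE_univ.exists_continuous_eqOn hA hf
  exact ⟨M, hM, fun x y hy => (hMf (hmaj x y hy).1).trans (hmaj x y hy).2⟩
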